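/- Let $L_0$ be the first-order language of group theory: equality, a binary operation symbol $\cdot$, a unary operation symbol ${}^{-1}$ and a constant symbol $1$. A sentence of $L_0$ is called a $\Pi_2$-sentence if it is logically equivalent to one of the form $\forall x_1\cdots\forall x_m\,\exists y_1\cdots\exists y_n\,\psi(x_1,\dots,x_m,y_1,\dots,y_n)$ with $m,n\ge 0$ and $\psi$ quantifier-free. A group $G$ is called almost locally free if every $\Pi_2$-sentence of $L_0$ that is true in the free group $F_2$ of rank $2$ is true in $G$. Theorem. Every finitely presented almost locally free group $G$ has solvable conjugacy problem; that is, for every finite tuple $(a_1,\dots,a_m)$ generating $G$ there is an algorithm which, given two words in the letters $a_1^{\pm1},\dots,a_m^{\pm1}$, decides whether or not they represent conjugate elements of $G$. -/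

import Mathlib

open FirstOrder

/-- The function symbols of the language of group theory: a binary operation symbol, a unary
operation symbol (inversion) and a constant symbol. -/
inductive GroupFunc : ℕ → Type
  | mul : GroupFunc 2
  | inv : GroupFunc 1
  | one : GroupFunc 0

/-- The first-order language of group theory. Equality is its only relation symbol; it is built
into first-order formulas and always interpreted as the identity relation. -/
def groupLanguage : FirstOrder.Language.{0, 0} where
  Functions := GroupFunc
  Relations := fun _ => Empty

/-- Every group is a structure for the language of group theory. -/
instance groupStructure (G : Type*) [Group G] : groupLanguage.Structure G where
  funMap := fun {n} (f : GroupFunc n) =>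
    match n, f with
    | _, .mul => fun x => x 0 * x 1
    | _, .inv => fun x => (x 0)⁻¹
    | _, .one => fun _ => 1
  RelMap := fun {_} r _ => r.elim

/-- Formulas `∀ x₁ … ∀ xₘ ∃ y₁ … ∃ yₙ ψ` with `ψ` free of quantifiers (`m = 0` and `n = 0`
are allowed). -/
inductive IsUniversalExistential :
    ∀ {n : ℕ}, groupLanguage.BoundedFormula Empty n → Prop
  | of_isExistential {n : ℕ} {φ : groupLanguage.BoundedFormula Empty n}
      (h : φ.IsExistential) : IsUniversalExistential φ
  | all {n : ℕ} {φ : groupLanguage.BoundedFormula Empty (n + 1)}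
      (h : IsUniversalExistential φ) : IsUniversalExistential φ.all

/-- A `Π₂`-sentence is a sentence logically equivalent to a universal-existential sentence. -/
def IsPiTwo (φ : groupLanguage.Sentence) : Prop :=
  ∃ ψ : groupLanguage.Sentence, IsUniversalExistential ψ ∧ φ ⇔[(∅ : groupLanguage.Theory)] ψ

/-- The set of all `Π₂`-sentences that are true in the free group of rank two. -/
def freeGroupPiTwoTheory : groupLanguage.Theory :=
  {φ | φ ∈ groupLanguage.completeTheory (FreeGroup (Fin 2)) ∧ IsPiTwo φ}

/-- A group is almost locally free if every `Π₂`-sentence of the language of group theory that is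
true in the free group of rank two is true in it. -/
def IsAlmostLocallyFree (G : Type*) [Group G] : Prop :=
  G ⊨ freeGroupPiTwoTheory

/-- The element of `G` represented by a (not necessarily reduced) word in the letters `aᵢ` and
`aᵢ⁻¹`; the letter `(i, true)` stands for `aᵢ` and `(i, false)` for `aᵢ⁻¹`. -/
def wordValue {G : Type*} [Group G] {m : ℕ} (a : Fin m → G) (w : List (Fin m × Bool)) : G :=
  FreeGroup.lift a (FreeGroup.mk w)

/-- A group has solvable conjugacy problem if it is finitely generated and, for every finite tuple
of generators, there is an algorithm that decides for any two words in these generators and their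
inverses whether or not they represent conjugate elements. -/
def HasSolvableConjugacyProblem (G : Type*) [Group G] : Prop :=
  Group.FG G ∧ ∀ (m : ℕ) (a : Fin m → G), Subgroup.closure (Set.range a) = ⊤ →
    ComputablePred fun p : List (Fin m × Bool) × List (Fin m × Bool) =>
      IsConj (wordValue a p.1) (wordValue a p.2)

/-! By Post's theorem it is enough that conjugacy and non-conjugacy are both semidecidable.
Conjugacy is so in any finitely presented group: search for a conjugator together with an expression
of the resulting relation as a product of conjugates of relators and their inverses.

For non-conjugacy, suppose that every homomorphism from `G` to the free group `F₂` makes `u` and `v`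
conjugate. Then `F₂` satisfies the sentence `∀ x ∃ y, (all relators vanish at x) → y * u(x) = v(x) *
y`. It is `Π₂`, so it holds in `G`, and its value at the generators shows that `u` and `v` are
conjugate in `G` (`IsAlmostLocallyFree.isConj_wordValue`). Hence non-conjugate elements are
separated by some homomorphism to `F₂`. Such a homomorphism is a finite tuple of words killing the
relators, and it can be searched for because conjugacy in a free group is decidable
(`FreeGroup.isConj_mk_iff`). -/

namespace FreeGroup

/-! ### Conjugacy in free groups -/

variable {α : Type*} {u v w : List (α × Bool)}

theorem isCyclicallyReduced_iff_isReduced_append_self :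
    IsCyclicallyReduced u ↔ IsReduced (u ++ u) := by
  rw [isCyclicallyReduced_iff, IsReduced, IsReduced, List.isChain_append]
  tauto

/-- The square of `v ++ u` is a factor of the cube of `u ++ v`, which is reduced. -/
theorem IsCyclicallyReduced.append_comm (h : IsCyclicallyReduced (u ++ v)) :
    IsCyclicallyReduced (v ++ u) := by
  have h3 := (h.flatten_replicate 3).isReduced
  rw [isCyclicallyReduced_iff_isReduced_append_self]
  exact h3.infix ⟨u, v, by simp [List.replicate_succ]⟩

theorem mk_eq_mk_iff_of_isReduced (hu : IsReduced u) (hv : IsReduced v) :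
    mk u = mk v ↔ u = v := by
  classical
  refine ⟨fun h => ?_, fun h => h ▸ rfl⟩
  rw [← hu.reduce_eq, ← hv.reduce_eq]
  exact reduce.sound h

theorem IsReduced.invRev (h : IsReduced u) : IsReduced (invRev u) := by
  classical
  rw [isReduced_iff_reduce_eq, reduce_invRev, h.reduce_eq]

/-- Cyclically reduced words that represent conjugate elements are cyclic permutations of each
other. -/
theorem IsCyclicallyReduced.isRotated_of_conj (hu : IsCyclicallyReduced u)
    (hv : IsCyclicallyReduced v) (hw : IsReduced w)
    (h : mk w * mk u * (mk w)⁻¹ = mk v) : u ~r v := by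
  induction w using List.reverseRecOn generalizing u with
  | nil =>
    rw [← one_eq_mk] at h
    rw [(mk_eq_mk_iff_of_isReduced hu.isReduced hv.isReduced).1 (by simpa using h)]
  | append_singleton w a ih =>
    have hw' : IsReduced w := hw.infix ⟨[], [a], by simp⟩
    rcases u with _ | ⟨b, u⟩
    · have : mk ([] : List (α × Bool)) = mk v := by
        rw [← h, ← one_eq_mk, mul_one, mul_inv_cancel]
      rw [(mk_eq_mk_iff_of_isReduced hu.isReduced hv.isReduced).1 this]
    -- Does the last letter `a` of the conjugator fail to cancel against the first letter `b` of the
    -- cyclically reduced word?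
    by_cases hab : a.1 = b.1 → a.2 = b.2
    · obtain ⟨s, d, hs⟩ : ∃ s d, b :: u = s ++ [d] :=
        ⟨_, _, (List.dropLast_append_getLast (List.cons_ne_nil b u)).symm⟩
      -- If the word is `s d` with `d = a`, conjugation by `a` yields the rotation `d s`, and the
      -- shorter conjugator `w` remains.
      by_cases hda : d = a
      · subst hda
        have hrot : b :: u ~r [d] ++ s := by
          rw [hs]; exact List.isRotated_append
        refine hrot.trans (ih (hs ▸ hu).append_comm hw' ?_)
        rw [← h, hs]
        simp only [← mul_mk]
        group
      -- Nothing cancels at either junction, so the full product is reduced and equals `v`; but it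
      -- ends with the inverse of its first letter.
      · exfalso
        have h1 : IsReduced (w ++ [a] ++ b :: u) := by
          refine List.isChain_append.2 ⟨hw, hu.isReduced, ?_⟩
          simpa using hab
        have h2 : IsReduced (b :: u ++ invRev (w ++ [a])) := by
          refine List.isChain_append.2 ⟨hu.isReduced, hw.invRev, ?_⟩
          rw [hs]
          rcases a with ⟨a, x⟩
          rcases d with ⟨d, y⟩
          simp only [invRev, List.map_append, List.map_cons, List.map_nil, List.reverse_append,
            List.reverse_singleton, List.singleton_append, List.getLast?_concat, List.head?_cons,
            Option.mem_some_iff]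
          rintro _ rfl _ rfl hd
          simp only at hd ⊢
          subst hd
          cases x <;> cases y <;> simp_all
        have h3 := h1.append_overlap h2 (List.cons_ne_nil b u)
        have h4 := (mk_eq_mk_iff_of_isReduced h3 hv.isReduced).1
          (by rw [← mul_mk, ← mul_mk, ← inv_mk, h])
        subst h4
        obtain ⟨e, t, he⟩ : ∃ e t, w ++ [a] = e :: t := List.exists_cons_of_ne_nil (by simp)
        have hlast : (w ++ [a] ++ b :: u ++ invRev (w ++ [a])).getLast? = some (e.1, !e.2) := by
          rw [he]
          simp only [invRev, List.map_cons, List.reverse_cons, ← List.append_assoc,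
            List.getLast?_concat]
        have := hv.2 (e.1, !e.2) hlast e (by simp [he]) rfl
        simp at this
    -- Here `a` is inverse to `b`, so conjugation by `a` moves `b` to the end.
    · obtain ⟨a1, a2⟩ := a
      obtain ⟨b1, b2⟩ := b
      simp only [Classical.not_imp] at hab
      obtain ⟨rfl, hab⟩ := hab
      have hrot : (a1, b2) :: u ~r u ++ [(a1, b2)] :=
        List.isRotated_append (l := [(a1, b2)]) (l' := u)
      refine hrot.trans (ih (IsCyclicallyReduced.append_comm (u := [(a1, b2)]) hu) hw' ?_)
      have hinv : mk [(a1, a2)] = (mk [(a1, b2)])⁻¹ := by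
        rw [inv_mk]; cases a2 <;> cases b2 <;> simp_all [invRev]
      rw [← h, ← List.singleton_append (l := u)]
      simp only [← mul_mk, hinv]
      group

/-- Two elements of a free group are conjugate if and only if conjugating each of them by some
prefix of its reduced word leads to the same element. -/
theorem isConj_mk_iff [DecidableEq α] :
    IsConj (mk u) (mk v) ↔ ∃ i < (reduce u).length + 1, ∃ j < (reduce v).length + 1,
      reduce (invRev ((reduce u).take i) ++ u ++ (reduce u).take i) =
        reduce (invRev ((reduce v).take j) ++ v ++ (reduce v).take j) := by
  constructor
  · intro h
    have hu : IsReduced (reduce u) := .of_reduce_eq reduce.idem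
    have hv : IsReduced (reduce v) := .of_reduce_eq reduce.idem
    have hu' := reduceCyclically.conj_conjugator_reduceCyclically (reduce u)
    have hv' := reduceCyclically.conj_conjugator_reduceCyclically (reduce v)
    have hcu := reduceCyclically.isCyclicallyReduced hu
    have hcv := reduceCyclically.isCyclicallyReduced hv
    generalize reduceCyclically.conjugator (reduce u) = g at *
    generalize reduceCyclically.conjugator (reduce v) = k at *
    generalize reduceCyclically (reduce u) = c at *
    generalize reduceCyclically (reduce v) = d at *
    have eu : mk u = mk g * mk c * (mk g)⁻¹ := by
      rw [← reduce.self (L := u), ← hu', ← mul_mk, ← mul_mk, inv_mk]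
    have ev : mk v = mk k * mk d * (mk k)⁻¹ := by
      rw [← reduce.self (L := v), ← hv', ← mul_mk, ← mul_mk, inv_mk]
    obtain ⟨x, hx⟩ := isConj_iff.1 h
    have hcd : c ~r d := by
      refine hcu.isRotated_of_conj hcv (w := ((mk k)⁻¹ * x * mk g).toWord) isReduced_toWord ?_
      rw [mk_toWord]
      rw [eu, ev] at hx
      have : mk d = (mk k)⁻¹ * (mk k * mk d * (mk k)⁻¹) * mk k := by group
      rw [this, ← hx]
      group
    obtain ⟨n, hn, rfl⟩ := List.isRotated_iff_mod.1 hcd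
    rw [List.rotate_eq_drop_append_take hn] at ev hv'
    have hc := List.take_append_drop n c
    generalize c.take n = s at *
    generalize c.drop n = t at *
    subst hc
    have pu : (reduce u).take (g ++ s).length = g ++ s := by
      rw [← hu', show g ++ (s ++ t) ++ invRev g = (g ++ s) ++ (t ++ invRev g) by simp,
        List.take_left]
    have pv : (reduce v).take k.length = k := by
      rw [← hv', List.append_assoc, List.take_left]
    -- Now `u = g s t g⁻¹` and `v = k t s k⁻¹`, so the prefixes `g s` and `k` both lead to `t s`.
    refine ⟨(g ++ s).length, ?_, k.length, ?_, ?_⟩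
    · rw [← hu']; simp
    · rw [← hv']; simp
    · rw [pu, pv]
      apply reduce.sound
      simp only [← mul_mk, ← inv_mk, eu, ev]
      group
  · rintro ⟨i, -, j, -, h⟩
    have h := reduce.exact h
    simp only [← mul_mk, ← inv_mk] at h
    generalize mk ((reduce u).take i) = p at h
    generalize mk ((reduce v).take j) = q at h
    rw [isConj_iff]
    refine ⟨q * p⁻¹, ?_⟩
    have : mk v = q * (q⁻¹ * mk v * q) * q⁻¹ := by group
    rw [this, ← h]
    group

end FreeGroup

/-! ### Unbounded search, and computability of operations on words -/

/-- Run through all codes `k` of possible witnesses; the search halts exactly when one of them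
passes the test. -/
theorem REPred.exists_of_computablePred {α β : Type*} [Primcodable α] [Primcodable β]
    {p : α × β → Prop} (hp : ComputablePred p) : REPred fun a => ∃ b, p (a, b) := by
  obtain ⟨_, hp⟩ := hp
  have hf : Computable₂ fun (a : α) (k : ℕ) =>
      (Encodable.decode (α := β) k).bind fun b => bif decide (p (a, b)) then some () else none :=
    Computable.option_bind (Computable.decode.comp Computable.snd)
      (Computable.cond (hp.comp ((Computable.fst.comp Computable.fst).pair Computable.snd))
        (Computable.const _) (Computable.const _))
  refine (Partrec.rfindOpt hf).dom_re.of_eq fun a => ?_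
  rw [Nat.rfindOpt_dom]
  constructor
  · rintro ⟨k, u, hu⟩
    obtain ⟨b, -, hb⟩ := Option.mem_bind_iff.1 hu
    refine ⟨b, ?_⟩
    by_contra h
    simp [h] at hb
  · rintro ⟨b, hb⟩
    exact ⟨Encodable.encode b, (), by simp [hb]⟩

theorem ComputablePred.comp {α β : Type*} [Primcodable α] [Primcodable β] {p : β → Prop}
    {f : α → β} (hp : ComputablePred p) (hf : Computable f) : ComputablePred fun a => p (f a) := by
  obtain ⟨_, hp⟩ := hp
  exact ⟨fun a => inferInstance, hp.comp hf⟩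

namespace FreeGroup

open Primrec

variable {α β : Type*}

/-- The word obtained by replacing each letter by a word. -/
def substWord (f : α → List (β × Bool)) (w : List (α × Bool)) : List (β × Bool) :=
  w.flatMap fun l => if l.2 then f l.1 else invRev (f l.1)

theorem mk_substWord (f : α → List (β × Bool)) (w : List (α × Bool)) :
    mk (substWord f w) = lift (fun i => mk (f i)) (mk w) := by
  induction w with
  | nil => simp [substWord, one_eq_mk]
  | cons l w ih =>
    have : substWord f (l :: w) = (if l.2 then f l.1 else invRev (f l.1)) ++ substWord f w := rfl
    rw [this, ← mul_mk, ih, lift_mk, lift_mk, List.map_cons, List.prod_cons]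
    cases l.2 <;> simp

variable [Primcodable α] [Primcodable β]

theorem primrec_invRev : Primrec (invRev (α := α)) :=
  list_reverse.comp (list_map Primrec.id
    (((fst.comp snd).pair (Primrec.not.comp (snd.comp snd))).to₂))

/-- Reduction is a right fold: each letter cancels against the head of the word already reduced or
is put in front of it. -/
theorem primrec_reduce [DecidableEq α] : Primrec (reduce (α := α)) := by
  have hstep : Primrec₂ fun (_ : List (α × Bool)) (q : (α × Bool) × List (α × Bool)) =>
      (List.casesOn q.2 [q.1] fun hd tl =>
        if q.1.1 = hd.1 ∧ q.1.2 = !hd.2 then tl else q.1 :: hd :: tl : List (α × Bool)) := by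
    have hq : Primrec fun x : (List (α × Bool) × (α × Bool) × List (α × Bool)) ×
        (α × Bool) × List (α × Bool) => x.1.2.1 := fst.comp (snd.comp fst)
    have hd : Primrec fun x : (List (α × Bool) × (α × Bool) × List (α × Bool)) ×
        (α × Bool) × List (α × Bool) => x.2.1 := fst.comp snd
    refine list_casesOn (h := fun (x : List (α × Bool) × (α × Bool) × List (α × Bool))
      (y : (α × Bool) × List (α × Bool)) =>
        if x.2.1.1 = y.1.1 ∧ x.2.1.2 = !y.1.2 then y.2 else x.2.1 :: y.1 :: y.2)
      (snd.comp snd) (list_cons.comp (fst.comp snd) (const [])) ?_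
    exact Primrec.ite (.and (Primrec.eq.comp (fst.comp hq) (fst.comp hd))
      (Primrec.eq.comp (snd.comp hq) (Primrec.not.comp (snd.comp hd)))) (snd.comp snd)
      (list_cons.comp hq (list_cons.comp hd (snd.comp snd)))
  refine (list_foldr Primrec.id (const []) hstep).of_eq fun w => ?_
  induction w with
  | nil => rfl
  | cons x w ih => rw [reduce.cons, ← ih]; rfl

/-- By `isConj_mk_iff` only prefixes of the reduced words need testing, so the search is bounded. -/
theorem primrecPred_isConj_mk [DecidableEq α] :
    PrimrecPred fun p : List (α × Bool) × List (α × Bool) => IsConj (mk p.1) (mk p.2) := by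
  have hconj : Primrec₂ fun (w : List (α × Bool)) (i : ℕ) =>
      reduce (invRev ((reduce w).take i) ++ w ++ (reduce w).take i) := by
    have ht : Primrec fun p : List (α × Bool) × ℕ => (reduce p.1).take p.2 :=
      list_take.comp snd (primrec_reduce.comp fst)
    exact primrec_reduce.comp
      (list_append.comp (list_append.comp (primrec_invRev.comp ht) fst) ht)
  have hlen : Primrec fun w : List (α × Bool) => List.range ((reduce w).length + 1) :=
    list_range.comp (succ.comp (list_length.comp primrec_reduce))
  have h1 : PrimrecRel fun (j : ℕ) (q : ℕ × List (α × Bool) × List (α × Bool)) =>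
      reduce (invRev ((reduce q.2.1).take q.1) ++ q.2.1 ++ (reduce q.2.1).take q.1) =
        reduce (invRev ((reduce q.2.2).take j) ++ q.2.2 ++ (reduce q.2.2).take j) :=
    Primrec.eq.comp (hconj.comp (fst.comp (snd.comp snd)) (fst.comp snd))
      (hconj.comp (snd.comp (snd.comp snd)) fst)
  have h2 : PrimrecRel fun (i : ℕ) (p : List (α × Bool) × List (α × Bool)) =>
      ∃ j ∈ List.range ((reduce p.2).length + 1),
      reduce (invRev ((reduce p.1).take i) ++ p.1 ++ (reduce p.1).take i) =
        reduce (invRev ((reduce p.2).take j) ++ p.2 ++ (reduce p.2).take j) :=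
    h1.exists_mem_list.comp (hlen.comp (snd.comp snd)) Primrec.id
  refine (h2.exists_mem_list.comp (hlen.comp fst) Primrec.id).of_eq fun p => ?_
  rw [isConj_mk_iff]
  simp only [List.mem_range, id]

theorem primrec_substWord {m : ℕ} :
    Primrec₂ (substWord (α := Fin m) (β := β)) := by
  have hf : Primrec fun x : ((Fin m → List (β × Bool)) × List (Fin m × Bool)) × Fin m × Bool =>
      x.1.1 x.2.1 := fin_app.comp (fst.comp fst) (fst.comp snd)
  refine list_flatMap snd ?_
  exact Primrec.ite (Primrec.eq.comp (snd.comp snd) (const true)) hf (primrec_invRev.comp hf)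

end FreeGroup

/-! ### Transfer of conjugacy from the free group by `Π₂`-sentences -/

section Formulas

open FirstOrder.Language

variable {G : Type*} [Group G] {β : Type} {n : ℕ}

theorem realize_mul (s : β → G) (t t' : groupLanguage.Term β) :
    (Functions.apply₂ (L := groupLanguage) GroupFunc.mul t t').realize s =
      t.realize s * t'.realize s :=
  Term.realize_functions_apply₂

theorem realize_inv (s : β → G) (t : groupLanguage.Term β) :
    (Functions.apply₁ (L := groupLanguage) GroupFunc.inv t).realize s = (t.realize s)⁻¹ :=
  Term.realize_functions_apply₁

/-- The term that a word becomes when its letters are replaced by terms. -/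
def wordTerm (t : Fin n → groupLanguage.Term β) : List (Fin n × Bool) → groupLanguage.Term β
  | [] => Constants.term (L := groupLanguage) GroupFunc.one
  | (i, true) :: w => Functions.apply₂ (L := groupLanguage) GroupFunc.mul (t i) (wordTerm t w)
  | (i, false) :: w =>
    Functions.apply₂ (L := groupLanguage) GroupFunc.mul
      (Functions.apply₁ (L := groupLanguage) GroupFunc.inv (t i)) (wordTerm t w)

theorem wordValue_nil (x : Fin n → G) : wordValue x [] = 1 := by
  simp [wordValue]

theorem wordValue_cons (x : Fin n → G) (l : Fin n × Bool) (w : List (Fin n × Bool)) :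
    wordValue x (l :: w) = (if l.2 then x l.1 else (x l.1)⁻¹) * wordValue x w := by
  simp [wordValue, FreeGroup.lift_mk, Bool.cond_eq_ite]

theorem realize_wordTerm (t : Fin n → groupLanguage.Term β) (s : β → G)
    (w : List (Fin n × Bool)) :
    (wordTerm t w).realize s = wordValue (fun i => (t i).realize s) w := by
  induction w with
  | nil => rw [wordTerm, wordValue_nil]; rfl
  | cons l w ih =>
    obtain ⟨i, b⟩ := l
    rw [wordValue_cons, ← ih]
    cases b
    · rw [wordTerm, realize_mul, realize_inv]; rfl
    · rw [wordTerm, realize_mul]; rfl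

/-- The formula saying of `x₁, …, xₙ, y` that `y * u(x) = v(x) * y` if all words in `R` vanish
at `x`. -/
def conjugatorFormula (R : List (List (Fin n × Bool))) (u v : List (Fin n × Bool)) :
    groupLanguage.BoundedFormula Empty (n + 1) :=
  let x : Fin n → groupLanguage.Term (Empty ⊕ Fin (n + 1)) := fun i => .var (.inr i.castSucc)
  let y : groupLanguage.Term (Empty ⊕ Fin (n + 1)) := .var (.inr (Fin.last n))
  R.foldr (fun r φ => ((wordTerm x r).bdEqual (wordTerm x [])).imp φ)
    (Term.bdEqual (Functions.apply₂ (L := groupLanguage) GroupFunc.mul y (wordTerm x u))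
      (Functions.apply₂ (L := groupLanguage) GroupFunc.mul (wordTerm x v) y))

theorem isQF_conjugatorFormula (R : List (List (Fin n × Bool))) (u v : List (Fin n × Bool)) :
    (conjugatorFormula R u v).IsQF := by
  induction R with
  | nil => exact (BoundedFormula.IsAtomic.equal _ _).isQF
  | cons r R ih => exact (BoundedFormula.IsAtomic.equal _ _).isQF.imp ih

theorem realize_conjugatorFormula (R : List (List (Fin n × Bool))) (u v : List (Fin n × Bool))
    (e : Empty → G) (x : Fin n → G) (y : G) :
    (conjugatorFormula R u v).Realize e (Fin.snoc x y) ↔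
      ((∀ r ∈ R, wordValue x r = 1) → y * wordValue x u = wordValue x v * y) := by
  have hw : ∀ w : List (Fin n × Bool),
      (wordTerm (fun i => (Term.var (.inr i.castSucc) :
        groupLanguage.Term (Empty ⊕ Fin (n + 1)))) w).realize
          (Sum.elim e (Fin.snoc x y : Fin (n + 1) → G)) = wordValue x w := by
    intro w
    rw [realize_wordTerm]
    simp
  induction R with
  | nil =>
    have hy : (Term.var (.inr (Fin.last n)) :
        groupLanguage.Term (Empty ⊕ Fin (n + 1))).realize
          (Sum.elim e (Fin.snoc x y : Fin (n + 1) → G)) = y := by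
      simp
    rw [conjugatorFormula, List.foldr_nil, BoundedFormula.realize_bdEqual, realize_mul,
      realize_mul, hw, hw, hy]
    simp
  | cons r R ih =>
    rw [conjugatorFormula, List.foldr_cons, BoundedFormula.realize_imp,
      BoundedFormula.realize_bdEqual, hw, hw, wordValue_nil, List.forall_mem_cons, and_imp]
    exact imp_congr_right fun _ => ih

/-- The sentence saying that, for all `x₁, …, xₙ` at which the words in `R` vanish, the elements
`u(x)` and `v(x)` are conjugate. -/
def conjugacySentence (R : List (List (Fin n × Bool))) (u v : List (Fin n × Bool)) :
    groupLanguage.Sentence :=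
  (conjugatorFormula R u v).ex.alls

theorem IsUniversalExistential.alls : ∀ {n : ℕ} {φ : groupLanguage.BoundedFormula Empty n},
    IsUniversalExistential φ → IsUniversalExistential φ.alls
  | 0, _, h => h
  | _ + 1, _, h => h.all.alls

theorem isPiTwo_conjugacySentence (R : List (List (Fin n × Bool))) (u v : List (Fin n × Bool)) :
    IsPiTwo (conjugacySentence R u v) :=
  ⟨_, (IsUniversalExistential.of_isExistential
    (isQF_conjugatorFormula R u v).isExistential.ex).alls, Theory.Iff.refl _⟩

theorem realize_conjugacySentence (R : List (List (Fin n × Bool)))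
    (u v : List (Fin n × Bool)) :
    G ⊨ conjugacySentence R u v ↔
      ∀ x : Fin n → G, (∀ r ∈ R, wordValue x r = 1) →
        IsConj (wordValue x u) (wordValue x v) := by
  rw [Sentence.Realize, conjugacySentence, BoundedFormula.realize_alls]
  refine forall_congr' fun x => ?_
  rw [BoundedFormula.realize_ex]
  simp only [realize_conjugatorFormula, isConj_iff, mul_inv_eq_iff_eq_mul]
  refine ⟨fun ⟨c, hc⟩ hR => ⟨c, hc hR⟩, fun h => ?_⟩
  by_cases hR : ∀ r ∈ R, wordValue x r = 1
  · obtain ⟨c, hc⟩ := h hR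
    exact ⟨c, fun _ => hc⟩
  -- The quantifier over conjugators stands outside the implication; where some relator does not
  -- vanish, any element serves.
  · exact ⟨1, fun h => absurd h hR⟩

/-- If two words become conjugate whenever their letters are replaced by elements of the free group
of rank two at which the words in `R` vanish, then the same is true in every almost locally free
group. -/
theorem IsAlmostLocallyFree.isConj_wordValue (hG : IsAlmostLocallyFree G)
    {R : List (List (Fin n × Bool))} {u v : List (Fin n × Bool)}
    (h : ∀ f : Fin n → FreeGroup (Fin 2), (∀ r ∈ R, wordValue f r = 1) →
      IsConj (wordValue f u) (wordValue f v))
    {x : Fin n → G} (hx : ∀ r ∈ R, wordValue x r = 1) :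
    IsConj (wordValue x u) (wordValue x v) := by
  have hmem : conjugacySentence R u v ∈ freeGroupPiTwoTheory :=
    ⟨(realize_conjugacySentence R u v).2 h, isPiTwo_conjugacySentence R u v⟩
  have : G ⊨ freeGroupPiTwoTheory := hG
  exact (realize_conjugacySentence R u v).1 (Theory.realize_sentence_of_mem _ hmem) x hx

end Formulas

/-! ### Semidecidability of conjugacy and of non-conjugacy -/

section Presentation

open FreeGroup Primrec

variable {α : Type*}

/-- The product, in the group of words, of conjugates of words. -/
def conjugatesProduct (c : List (List (α × Bool) × List (α × Bool))) : List (α × Bool) :=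
  c.flatMap fun q => q.1 ++ q.2 ++ invRev q.1

/-- As a monoid, the normal closure is generated by the conjugates of relators and of their
inverses. The list `c` is a finite certificate that can be enumerated and checked. -/
theorem mk_mem_normalClosure_iff {R : List (List (α × Bool))} {w : List (α × Bool)} :
    mk w ∈ Subgroup.normalClosure {x | ∃ r ∈ R, mk r = x} ↔
      ∃ c : List (List (α × Bool) × List (α × Bool)),
        (∀ q ∈ c, q.2 ∈ R ++ R.map invRev) ∧ mk (conjugatesProduct c) = mk w := by
  have hcons (q : List (α × Bool) × List (α × Bool)) (c) :
      mk (conjugatesProduct (q :: c)) =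
        mk q.1 * mk q.2 * (mk q.1)⁻¹ * mk (conjugatesProduct c) := by
    simp [conjugatesProduct]
  constructor
  · intro hw
    rw [Subgroup.normalClosure, ← Subgroup.mem_toSubmonoid, Subgroup.closure_toSubmonoid] at hw
    obtain ⟨l, hl, hw⟩ := Submonoid.exists_list_of_mem_closure hw
    rw [← hw]
    clear hw
    induction l with
    | nil => exact ⟨[], by simp, by simp [conjugatesProduct, one_eq_mk]⟩
    | cons x l ih =>
      obtain ⟨c, hc, hcl⟩ := ih fun y hy => hl y (List.mem_cons_of_mem _ hy)
      obtain ⟨g, s, hs, hx⟩ : ∃ g s, s ∈ R ++ R.map invRev ∧ mk g * mk s * (mk g)⁻¹ = x := by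
        rcases hl x List.mem_cons_self with h | h
        all_goals
          obtain ⟨_, ⟨r, hr, rfl⟩, hx⟩ := Group.mem_conjugatesOfSet_iff.1 h
          obtain ⟨⟨g⟩, hx⟩ := isConj_iff.1 hx
          rw [quot_mk_eq_mk] at hx
        · exact ⟨g, r, by simp [hr], hx⟩
        · refine ⟨g, invRev r, List.mem_append_right _ (List.mem_map_of_mem hr), ?_⟩
          rw [← inv_inj, ← hx, ← inv_mk]
          group
      refine ⟨(g, s) :: c, List.forall_mem_cons.2 ⟨hs, hc⟩, ?_⟩
      rw [hcons, hcl, hx, List.prod_cons]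
  · rintro ⟨c, hc, hw⟩
    rw [← hw]
    clear hw
    induction c with
    | nil => exact Subgroup.one_mem _
    | cons q c ih =>
      rw [List.forall_mem_cons] at hc
      rw [hcons]
      refine Subgroup.mul_mem _ (Subgroup.normalClosure_normal.conj_mem _ ?_ _) (ih hc.2)
      rcases List.mem_append.1 hc.1 with h | h
      · exact Subgroup.subset_normalClosure ⟨_, h, rfl⟩
      · obtain ⟨r, hr, hrq⟩ := List.mem_map.1 h
        rw [← hrq, ← inv_mk]
        exact Subgroup.inv_mem _ (Subgroup.subset_normalClosure ⟨_, hr, rfl⟩)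

theorem primrec_conjugatesProduct [Primcodable α] : Primrec (conjugatesProduct (α := α)) :=
  list_flatMap Primrec.id (list_append.comp (list_append.comp (fst.comp snd) (snd.comp snd))
    (primrec_invRev.comp (fst.comp snd)))

variable {G : Type*} [Group G]

/-- A certificate of conjugacy: `b.1` is a word for the conjugator, and `b.2` derives the relation
`b.1 u b.1⁻¹ v⁻¹ = 1` from the relators. -/
theorem isConj_map_mk_iff {φ : FreeGroup α →* G} (hφ : Function.Surjective φ)
    {R : List (List (α × Bool))}
    (hR : Subgroup.normalClosure {x | ∃ r ∈ R, mk r = x} = φ.ker) {u v : List (α × Bool)} :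
    IsConj (φ (mk u)) (φ (mk v)) ↔
      ∃ b : List (α × Bool) × List (List (α × Bool) × List (α × Bool)),
        (∀ q ∈ b.2, q.2 ∈ R ++ R.map invRev) ∧
          mk (conjugatesProduct b.2) = mk (b.1 ++ u ++ invRev b.1 ++ invRev v) := by
  simp only [Prod.exists, ← mk_mem_normalClosure_iff, hR, MonoidHom.mem_ker, isConj_iff]
  constructor
  · rintro ⟨g, hg⟩
    obtain ⟨⟨w⟩, rfl⟩ := hφ g
    exact ⟨w, by
      simpa only [← mul_mk, ← inv_mk, _root_.map_mul, _root_.map_inv, quot_mk_eq_mk,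
        mul_inv_eq_one] using hg⟩
  · rintro ⟨w, hw⟩
    exact ⟨φ (mk w), by
      simpa only [← mul_mk, ← inv_mk, _root_.map_mul, _root_.map_inv, quot_mk_eq_mk,
        mul_inv_eq_one] using hw⟩

/-- The conjugacy relation of a finitely presented group is recursively enumerable. -/
theorem rePred_isConj_map_mk {n : ℕ} {φ : FreeGroup (Fin n) →* G} (hφ : Function.Surjective φ)
    {R : List (List (Fin n × Bool))}
    (hR : Subgroup.normalClosure {x | ∃ r ∈ R, mk r = x} = φ.ker) :
    REPred fun p : List (Fin n × Bool) × List (Fin n × Bool) =>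
      IsConj (φ (mk p.1)) (φ (mk p.2)) := by
  have hmem : PrimrecPred fun c : List (List (Fin n × Bool) × List (Fin n × Bool)) =>
      ∀ q ∈ c, q.2 ∈ R ++ R.map invRev := by
    refine PrimrecPred.forall_mem_list ?_
    exact (Primrec.eq (α := List (Fin n × Bool)).exists_mem_list.comp
      (const (R ++ R.map invRev)) snd).of_eq fun q => by simp
  have hcheck : PrimrecPred fun x : (List (Fin n × Bool) × List (Fin n × Bool)) ×
      List (Fin n × Bool) × List (List (Fin n × Bool) × List (Fin n × Bool)) =>
      (∀ q ∈ x.2.2, q.2 ∈ R ++ R.map invRev) ∧ reduce (conjugatesProduct x.2.2) =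
        reduce (x.2.1 ++ x.1.1 ++ invRev x.2.1 ++ invRev x.1.2) :=
    (hmem.comp (snd.comp snd)).and (Primrec.eq.comp
      (primrec_reduce.comp (primrec_conjugatesProduct.comp (snd.comp snd)))
      (primrec_reduce.comp (list_append.comp (list_append.comp (list_append.comp (fst.comp snd)
        (fst.comp fst)) (primrec_invRev.comp (fst.comp snd)))
        (primrec_invRev.comp (snd.comp fst)))))
  refine (REPred.exists_of_computablePred hcheck.computablePred).of_eq fun p => ?_
  rw [isConj_map_mk_iff hφ hR]
  exact exists_congr fun b => and_congr_right fun _ => ⟨reduce.exact, reduce.sound⟩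

/-- The complement of the conjugacy relation of a finitely presented almost locally free group is
recursively enumerable: nonconjugate elements remain nonconjugate under some homomorphism to the
free group of rank two. -/
theorem IsAlmostLocallyFree.rePred_not_isConj_map_mk (hG : IsAlmostLocallyFree G) {n : ℕ}
    {φ : FreeGroup (Fin n) →* G} (hφ : Function.Surjective φ) {R : List (List (Fin n × Bool))}
    (hR : Subgroup.normalClosure {x | ∃ r ∈ R, mk r = x} = φ.ker) :
    REPred fun p : List (Fin n × Bool) × List (Fin n × Bool) =>
      ¬ IsConj (φ (mk p.1)) (φ (mk p.2)) := by
  have hcheck : PrimrecPred fun x : (List (Fin n × Bool) × List (Fin n × Bool)) ×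
      (Fin n → List (Fin 2 × Bool)) =>
      (∀ r ∈ R, reduce (substWord x.2 r) = []) ∧
        ¬ IsConj (mk (substWord x.2 x.1.1)) (mk (substWord x.2 x.1.2)) := by
    refine PrimrecPred.and ?_ ?_
    · have h : PrimrecRel fun (r : List (Fin n × Bool)) (f : Fin n → List (Fin 2 × Bool)) =>
          reduce (substWord f r) = [] :=
        Primrec.eq.comp (primrec_reduce.comp (primrec_substWord.comp snd fst)) (const [])
      exact h.forall_mem_list.comp (const R) snd
    · exact (primrecPred_isConj_mk.comp ((primrec_substWord.comp snd (fst.comp fst)).pair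
        (primrec_substWord.comp snd (snd.comp fst)))).not
  refine (REPred.exists_of_computablePred hcheck.computablePred).of_eq fun p => ?_
  have hword (w : List (Fin n × Bool)) : wordValue (fun i => φ (of i)) w = φ (mk w) :=
    DFunLike.congr_fun (FreeGroup.ext_hom (f := lift fun i => φ (of i)) φ (by simp)) _
  have hred (f : Fin n → List (Fin 2 × Bool)) (r : List (Fin n × Bool)) :
      reduce (substWord f r) = [] ↔ wordValue (fun i => mk (f i)) r = 1 := by
    rw [wordValue, ← mk_substWord, ← toWord_mk, toWord_eq_nil_iff]
  simp only [hred, mk_substWord]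
  constructor
  · rintro ⟨f, hf, hp⟩ h
    -- Killing the relators, `f` induces a homomorphism from `G` to the free group, which preserves
    -- conjugacy.
    have hker : φ.ker ≤ (lift fun i => mk (f i)).ker := by
      rw [← hR]
      refine Subgroup.normalClosure_le_normal ?_
      rintro _ ⟨r, hr, rfl⟩
      exact hf r hr
    refine hp ?_
    have := (φ.liftOfSurjective hφ ⟨_, hker⟩).map_isConj h
    simpa only [MonoidHom.liftOfRightInverse_comp_apply] using this
  -- If no `f` separates the two words, the conjugacy sentence holds in the free group, hence in `G`
  -- at the images of the generators.
  · contrapose!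
    intro h
    have hx : ∀ r ∈ R, wordValue (fun i => φ (of i)) r = 1 := fun r hr => by
      rw [hword, ← MonoidHom.mem_ker, ← hR]
      exact Subgroup.subset_normalClosure ⟨r, hr, rfl⟩
    rw [← hword, ← hword]
    refine hG.isConj_wordValue (fun f hf => ?_) hx
    have := h fun i => (f i).toWord
    simp only [mk_toWord] at this
    exact this hf

theorem IsAlmostLocallyFree.computablePred_isConj_map_mk (hG : IsAlmostLocallyFree G) {n : ℕ}
    {φ : FreeGroup (Fin n) →* G} (hφ : Function.Surjective φ)
    (hker : φ.ker.IsFinitelyNormallyGenerated) :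
    ComputablePred fun p : List (Fin n × Bool) × List (Fin n × Bool) =>
      IsConj (φ (mk p.1)) (φ (mk p.2)) := by
  obtain ⟨S, hS, hSker⟩ := hker
  have hR : Subgroup.normalClosure {x | ∃ r ∈ hS.toFinset.toList.map toWord, mk r = x} =
      φ.ker := by
    rw [← hSker]
    congr 1
    ext x
    simp [mk_toWord]
  exact ComputablePred.computable_iff_re_compl_re'.2
    ⟨rePred_isConj_map_mk hφ hR, hG.rePred_not_isConj_map_mk hφ hR⟩

end Presentation

theorem theorem13 (G : Type*) [Group G] [Group.IsFinitelyPresented G]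
    (hG : IsAlmostLocallyFree G) : HasSolvableConjugacyProblem G := by
  obtain ⟨n, φ, hφ, hker⟩ := ‹Group.IsFinitelyPresented G›
  refine ⟨Group.fg_of_surjective hφ, fun m a _ => ?_⟩
  -- An arbitrary generating tuple is reduced to that of the presentation by substituting for each
  -- `a i` a word representing it.
  choose t ht using fun i => hφ (a i)
  have hsubst : Computable (FreeGroup.substWord fun i => (t i).toWord) :=
    (FreeGroup.primrec_substWord.comp (Primrec.const _) Primrec.id).to_comp
  refine ((hG.computablePred_isConj_map_mk hφ hker).comp
    ((hsubst.comp .fst).pair (hsubst.comp .snd))).of_eq fun p => ?_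
  have hword (w : List (Fin m × Bool)) :
      φ (FreeGroup.mk (FreeGroup.substWord (fun i => (t i).toWord) w)) = wordValue a w := by
    rw [FreeGroup.mk_substWord, wordValue]
    simp only [FreeGroup.mk_toWord]
    exact DFunLike.congr_fun (FreeGroup.ext_hom (f := φ.comp (FreeGroup.lift t))
      (FreeGroup.lift a) (by simp [ht])) _
  rw [hword, hword]
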